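/- Let $R\ge 0$ be an integer, let $J$ be a real number, and let $t_0>0$. There is a constant $C$, depending only on $R$, $J$ and $t_0$, such that the following holds for every $N$ and $q$. Consider an open chain of $N$ sites with Hilbert space $(\mathbb C^q)^{\otimes N}$. Let $\|\cdot\|$ be the operator norm, and for a super-operator $\mathcal T$ (a linear map on operators) let $\|\mathcal T\|=\sup_{X\ne 0}\|\mathcal T\cdot X\|/\|X\|$. For each time $\tau$ let $$\mathcal L^\dagger_H(\tau)=\sum_{i=1}^N\mathcal L^\dagger_{H_i}(\tau),\qquad \mathcal L^\dagger_D(\tau)=\Gamma\sum_{k=1}^N\mathcal L^\dagger_{D,k}(\tau),\qquad \Gamma\ge 0,$$ where all the super-operators $\mathcal L^\dagger_{H_i}(\tau)$, $\mathcal L^\dagger_{D,k}(\tau)$ depend continuously on $\tau$ and, for all $\tau$: - $\mathcal L^\dagger_{H_i}(\tau)\cdot X=i[H_i(\tau),X]$, where $H_i(\tau)$ is Hermitian and acts only on the sites at distance at most $R$ from site $i$, and $\|\mathcal L^\dagger_{H_i}(\tau)\|\le J$; - $\mathcal L^\dagger_{D,k}(\tau)\cdot X=\sum_j\frac12\bigl(2L_{j}^\dagger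 XL_{j}-XL_{j}^\dagger L_{j}-L_{j}^\dagger L_{j}X\bigr)$ for finitely many Lindblad operators $L_j$ (depending on $k$ and $\tau$) that act only on site $k$, and $\|\mathcal L^\dagger_{D,k}(\tau)\|\le 1$. Let $$\mathcal V_1^\dagger(t,0)=\mathcal T_{\to}\,e^{\int_0^t(\mathcal L^\dagger_H(\tau)+\mathcal L^\dagger_D(\tau))\,d\tau},\qquad \mathcal V_0^\dagger(t,0)=\mathcal T_{\to}\,e^{\int_0^t\mathcal L^\dagger_H(\tau)\,d\tau}$$ be the dissipative and the unitary adjoint propagators, where $\mathcal T_\to$ orders products so that times increase from left to right. Then, for every operator $B$ (in particular, every observable) that acts only on a single site of the chain, and for all $t\ge t_0$, $$\bigl\|\mathcal V_1^\dagger(t,0)\cdot B-\mathcal V_0^\dagger(t,0)\cdot B\bigr\|\le \Gamma\, C\,t^2\,\|B\|.$$ -/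

import Mathlib

open scoped Matrix.Norms.L2Operator

noncomputable section

namespace SpinChain

/-- Operators on the Hilbert space `(ℂ^q)^{⊗ N}` of an open chain of `N` sites with `q` levels per
site, written as matrices in the product basis `|σ₁ … σ_N⟩`. They carry the operator norm induced
by the Hilbert space norm (the `L2Operator` scope). -/
abbrev Op (N q : ℕ) : Type := Matrix (Fin N → Fin q) (Fin N → Fin q) ℂ

/-- Super-operators: linear maps on operators, with the norm `sup ‖T X‖ / ‖X‖`
induced by the operator norm. Multiplication is composition. -/
abbrev SuperOp (N q : ℕ) : Type := Op N q →L[ℂ] Op N q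

/-- `A` acts only on the sites in `S`, that is, `A = a ⊗ 1` where `a` is an operator on the
sites in `S` and `1` is the identity on all the other sites. -/
def SupportedOn {N q : ℕ} (S : Finset (Fin N)) (A : Op N q) : Prop :=
  ∃ a : Matrix (S → Fin q) (S → Fin q) ℂ, ∀ σ τ : Fin N → Fin q,
    A σ τ = if ∀ k, k ∉ S → σ k = τ k then a (fun k => σ k) (fun k => τ k) else 0

/-- The sites of the chain at distance at most `R` from the site `i`. -/
def nbhd {N : ℕ} (R : ℕ) (i : Fin N) : Finset (Fin N) :=
  Finset.univ.filter fun j => (j : ℕ) ≤ i + R ∧ (i : ℕ) ≤ j + R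

/-- Left multiplication `X ↦ A X`. -/
def mulLeft {N q : ℕ} (A : Op N q) : SuperOp N q := ContinuousLinearMap.mul ℂ (Op N q) A

/-- Right multiplication `X ↦ X A`. -/
def mulRight {N q : ℕ} (A : Op N q) : SuperOp N q := (ContinuousLinearMap.mul ℂ (Op N q)).flip A

/-- The adjoint Liouvillian `X ↦ i [H, X]` of a Hamiltonian `H`. -/
def hamiltonianPart {N q : ℕ} (H : Op N q) : SuperOp N q :=
  Complex.I • (mulLeft H - mulRight H)

/-- The adjoint dissipator `X ↦ ∑ⱼ (1/2) (2 Lⱼ† X Lⱼ - X Lⱼ† Lⱼ - Lⱼ† Lⱼ X)` of a finite family of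
Lindblad operators. -/
def dissipator {N q m : ℕ} (L : Fin m → Op N q) : SuperOp N q :=
  ∑ j, (1 / 2 : ℂ) • ((2 : ℂ) • (mulLeft (L j).conjTranspose * mulRight (L j))
    - mulRight ((L j).conjTranspose * L j) - mulLeft ((L j).conjTranspose * L j))

/-- `T` is the adjoint Liouvillian of a Hamiltonian term that acts only on the sites in `S`. -/
def IsLocalHamiltonianLiouvillian {N q : ℕ} (S : Finset (Fin N)) (T : SuperOp N q) : Prop :=
  ∃ H : Op N q, H.IsHermitian ∧ SupportedOn S H ∧ T = hamiltonianPart H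

/-- `T` is an adjoint dissipator acting on the single site `k`: its Lindblad operators act only
on that site. -/
def IsSiteDissipator {N q : ℕ} (k : Fin N) (T : SuperOp N q) : Prop :=
  ∃ (m : ℕ) (L : Fin m → Op N q), (∀ j, SupportedOn {k} (L j)) ∧ T = dissipator L

/-- The terms of the Dyson series: `dysonTerm L s n t` is the integral of
`L τ₁ * L τ₂ * ⋯ * L τₙ` over `s ≤ τ₁ ≤ τ₂ ≤ ⋯ ≤ τₙ ≤ t`. -/
def dysonTerm {𝔸 : Type*} [NormedRing 𝔸] [NormedSpace ℝ 𝔸] (L : ℝ → 𝔸) (s : ℝ) : ℕ → ℝ → 𝔸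
  | 0, _ => 1
  | n + 1, t => ∫ τ in s..t, dysonTerm L s n τ * L τ

/-- The time-ordered exponential of `∫_s^t L τ dτ`, in which the times increase from left to
right. -/
def timeOrderedExp {𝔸 : Type*} [NormedRing 𝔸] [NormedSpace ℝ 𝔸] (L : ℝ → 𝔸) (t s : ℝ) : 𝔸 :=
  ∑' n, dysonTerm L s n t

end SpinChain

end

/-!
By Duhamel's formula `V₁(t) B - V₀(t) B = ∫₀ᵗ V₁(τ) D(τ) V₀(t, τ) B dτ`, where `D = Γ ∑ₖ Dₖ`, and
`V₁` is a contraction because Lindbladians are dissipative. Each `Dₖ` annihilates the operators that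
act trivially near `k`, so it only sees the fluctuation of `V₀(t, τ) B` there. A fluctuation is
driven only by the fluctuations on nearby sites; hence their sum with weights `e^{d(i, b)}` grows at
most exponentially in time. Only the sites in a light cone of radius `O(t)` then matter, the total
fluctuation is `O(t ‖B‖)`, and integrating over `τ` gives `Γ O(t²) ‖B‖`.
-/

namespace SpinChain

open Filter Topology Set
open scoped Interval Kronecker

section Dyson

variable {𝔸 : Type*} [NormedRing 𝔸] [NormedAlgebra ℝ 𝔸] {L : ℝ → 𝔸}

theorem continuous_dysonTerm (hL : Continuous L) (s : ℝ) (n : ℕ) :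
    Continuous (dysonTerm L s n) := by
  induction n with
  | zero => exact continuous_const
  | succ n ih =>
    exact intervalIntegral.continuous_primitive (fun a b => (ih.mul hL).intervalIntegrable a b) s

theorem timeOrderedExp_self (L : ℝ → 𝔸) (s : ℝ) : timeOrderedExp L s s = 1 := by
  have succ_term : ∀ n ≠ 0, dysonTerm L s n s = 0 := by
    rintro (_ | n) hn
    · exact absurd rfl hn
    · exact intervalIntegral.integral_same
  exact tsum_eq_single 0 succ_term

theorem norm_dysonTerm_le (hL : Continuous L) {I : Set ℝ} [I.OrdConnected] {M s t : ℝ}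
    (hLM : ∀ τ ∈ I, ‖L τ‖ ≤ M) (hs : s ∈ I) (ht : t ∈ I) (n : ℕ) :
    ‖dysonTerm L s n t‖ ≤ ‖(1 : 𝔸)‖ * ((M * |t - s|) ^ n / n.factorial) := by
  have hM : 0 ≤ M := (norm_nonneg _).trans (hLM s hs)
  induction n generalizing t with
  | zero => simp [dysonTerm]
  | succ n ih =>
    have hI : Ι s t ⊆ I := uIoc_subset_uIcc.trans (OrdConnected.uIcc_subset ‹_› hs ht)
    have hcont : Continuous fun τ => dysonTerm L s n τ * L τ :=
      (continuous_dysonTerm hL s n).mul hL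
    have integrand_le : ∀ τ ∈ Ι s t, ‖dysonTerm L s n τ * L τ‖
        ≤ ‖(1 : 𝔸)‖ * (M ^ (n + 1) / n.factorial) * |τ - s| ^ n := fun τ hτ =>
      calc ‖dysonTerm L s n τ * L τ‖ ≤ ‖dysonTerm L s n τ‖ * ‖L τ‖ := norm_mul_le _ _
        _ ≤ ‖(1 : 𝔸)‖ * ((M * |τ - s|) ^ n / n.factorial) * M := by
          gcongr
          exacts [ih (hI hτ), hLM τ (hI hτ)]
        _ = _ := by ring
    calc ‖dysonTerm L s (n + 1) t‖ ≤ ∫ τ in Ι s t, ‖dysonTerm L s n τ * L τ‖ :=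
          intervalIntegral.norm_integral_le_integral_norm_uIoc
      _ ≤ ∫ τ in Ι s t, ‖(1 : 𝔸)‖ * (M ^ (n + 1) / n.factorial) * |τ - s| ^ n :=
          MeasureTheory.setIntegral_mono_on
            (intervalIntegrable_iff.mp (hcont.norm.intervalIntegrable s t))
            (intervalIntegrable_iff.mp (Continuous.intervalIntegrable (by fun_prop) s t))
            measurableSet_uIoc integrand_le
      _ = ‖(1 : 𝔸)‖ * ((M * |t - s|) ^ (n + 1) / (n + 1).factorial) := by
          rw [MeasureTheory.integral_const_mul, integral_pow_abs_sub_uIoc, Nat.factorial_succ,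
            mul_pow]
          push_cast
          field_simp

variable [CompleteSpace 𝔸]

theorem summable_dysonTerm (hL : Continuous L) (s t : ℝ) :
    Summable fun n => dysonTerm L s n t := by
  obtain ⟨M, hM⟩ := isCompact_uIcc.exists_bound_of_continuousOn (hL.continuousOn (s := uIcc s t))
  exact .of_norm_bounded ((Real.summable_pow_div_factorial (M * |t - s|)).mul_left ‖(1 : 𝔸)‖)
    (norm_dysonTerm_le hL hM left_mem_uIcc right_mem_uIcc)

theorem hasDerivAt_dysonTerm_succ (hL : Continuous L) (s : ℝ) (n : ℕ) (t : ℝ) :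
    HasDerivAt (dysonTerm L s (n + 1)) (dysonTerm L s n t * L t) t :=
  ((continuous_dysonTerm hL s n).mul hL).integral_hasStrictDerivAt s t |>.hasDerivAt

theorem hasDerivAt_timeOrderedExp (hL : Continuous L) (s t : ℝ) :
    HasDerivAt (fun t => timeOrderedExp L t s) (timeOrderedExp L t s * L t) t := by
  set r : ℝ := |t - s| + 1
  have hr : 0 < r := by positivity
  obtain ⟨M, hM⟩ := (isCompact_closedBall s r).exists_bound_of_continuousOn hL.continuousOn
  have hM0 : 0 ≤ M := (norm_nonneg _).trans (hM s (Metric.mem_closedBall_self hr.le))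
  have : (Metric.closedBall s r).OrdConnected := (convex_closedBall s r).ordConnected
  have deriv_le : ∀ n, ∀ y ∈ Metric.ball s r,
      ‖dysonTerm L s n y * L y‖ ≤ ‖(1 : 𝔸)‖ * ((M * r) ^ n / n.factorial) * M := fun n y hy => by
    have hy' := Metric.ball_subset_closedBall hy
    have hyr : |y - s| ≤ r := hy'
    refine (norm_mul_le _ _).trans (mul_le_mul ?_ (hM y hy') (norm_nonneg _) (by positivity))
    refine (norm_dysonTerm_le hL hM (Metric.mem_closedBall_self hr.le) hy' n).trans ?_
    gcongr
  have ht : t ∈ Metric.ball s r := lt_add_one |t - s|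
  have hder := hasDerivAt_tsum_of_isPreconnected
    (((Real.summable_pow_div_factorial (M * r)).mul_left ‖(1 : 𝔸)‖).mul_right M)
    Metric.isOpen_ball (convex_ball s r).isPreconnected
    (fun n y _ => hasDerivAt_dysonTerm_succ hL s n y) deriv_le ht
    ((summable_nat_add_iff 1).mpr (summable_dysonTerm hL s t)) ht
  rw [(summable_dysonTerm hL s t).tsum_mul_right] at hder
  exact (hder.const_add 1).congr_of_eventuallyEq <| .of_forall fun y =>
    (summable_dysonTerm hL s y).tsum_eq_zero_add

/-- The solution is the time-ordered exponential of `-L` in the opposite algebra. -/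
theorem exists_hasDerivAt_neg_mul (hL : Continuous L) (t : ℝ) :
    ∃ W : ℝ → 𝔸, W t = 1 ∧ ∀ s, HasDerivAt W (-(L s * W s)) s := by
  have hL' : Continuous fun s => MulOpposite.op (-L s) := MulOpposite.continuous_op.comp hL.neg
  refine ⟨fun s => (timeOrderedExp (fun τ => MulOpposite.op (-L τ)) s t).unop, ?_, fun s => ?_⟩
  · simp only [timeOrderedExp_self, MulOpposite.unop_one]
  · have hunop := ((MulOpposite.opContinuousLinearEquiv ℝ (M := 𝔸)).symm :
      𝔸ᵐᵒᵖ →L[ℝ] 𝔸).hasFDerivAt.comp_hasDerivAt s (hasDerivAt_timeOrderedExp hL' t s)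
    exact hunop.congr_deriv (by simp)

theorem hasDerivAt_timeOrderedExp_left (hL : Continuous L) (t s : ℝ) :
    HasDerivAt (fun s => timeOrderedExp L t s) (-(L s * timeOrderedExp L t s)) s := by
  obtain ⟨W, hWt, hW⟩ := exists_hasDerivAt_neg_mul hL t
  have eq_W : (fun s => timeOrderedExp L t s) = W := funext fun s => by
    have hconst : ∀ r, HasDerivAt (fun r => timeOrderedExp L r s * W r) 0 r := fun r =>
      ((hasDerivAt_timeOrderedExp hL s r).fun_mul (hW r)).congr_deriv (by noncomm_ring)
    calc timeOrderedExp L t s = timeOrderedExp L t s * W t := by rw [hWt, mul_one]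
      _ = timeOrderedExp L s s * W s :=
          is_const_of_deriv_eq_zero (fun r => (hconst r).differentiableAt)
            (fun r => (hconst r).deriv) t s
      _ = W s := by rw [timeOrderedExp_self, one_mul]
  rw [congrFun eq_W s, eq_W]
  exact hW s

end Dyson

section Dini

/-- The upper right Dini derivative of `f` at `x` is at most `c`. It serves to differentiate norms
along curves. -/
def DiniDerivLE (f : ℝ → ℝ) (c x : ℝ) : Prop :=
  ∀ r > c, ∀ᶠ z in 𝓝[>] x, slope f x z < r

variable {f g : ℝ → ℝ} {c d x : ℝ}

theorem DiniDerivLE.mono (hf : DiniDerivLE f c x) (hcd : c ≤ d) : DiniDerivLE f d x :=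
  fun r hr => hf r (hcd.trans_lt hr)

theorem diniDerivLE_of_hasDerivAt (hf : HasDerivAt f c x) : DiniDerivLE f c x :=
  fun _ hr => hf.hasDerivWithinAt.limsup_slope_le' self_notMem_Ioi hr

theorem DiniDerivLE.of_le (hg : DiniDerivLE g c x) (hfg : ∀ᶠ z in 𝓝[>] x, f z ≤ g z)
    (hx : g x ≤ f x) : DiniDerivLE f c x := fun r hr => by
  filter_upwards [hg r hr, hfg, self_mem_nhdsWithin] with z hz hle (hxz : x < z)
  refine lt_of_le_of_lt ?_ hz
  rw [slope_def_field, slope_def_field]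
  have : 0 < z - x := sub_pos.mpr hxz
  gcongr

theorem DiniDerivLE.add (hf : DiniDerivLE f c x) (hg : DiniDerivLE g d x) :
    DiniDerivLE (fun z => f z + g z) (c + d) x := fun r hr => by
  filter_upwards [hf (c + (r - (c + d)) / 2) (by linarith),
    hg (d + (r - (c + d)) / 2) (by linarith)] with z hfz hgz
  have slope_add : slope (fun z => f z + g z) x z = slope f x z + slope g x z := by
    simp only [slope_def_field]
    ring
  linarith

theorem DiniDerivLE.sum {ι : Type*} (s : Finset ι) {f : ι → ℝ → ℝ} {c : ι → ℝ}
    (hf : ∀ i ∈ s, DiniDerivLE (f i) (c i) x) :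
    DiniDerivLE (fun z => ∑ i ∈ s, f i z) (∑ i ∈ s, c i) x := by
  induction s using Finset.cons_induction with
  | empty => simpa using diniDerivLE_of_hasDerivAt (hasDerivAt_const x (0 : ℝ))
  | cons i s hi ih =>
    simp only [Finset.sum_cons]
    exact (hf i (Finset.mem_cons_self i s)).add
      (ih fun j hj => hf j (Finset.mem_cons_of_mem hj))

theorem DiniDerivLE.const_mul {a : ℝ} (ha : 0 ≤ a) (hf : DiniDerivLE f c x) :
    DiniDerivLE (fun z => a * f z) (a * c) x := by
  rcases ha.eq_or_lt with rfl | ha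
  · simpa using diniDerivLE_of_hasDerivAt (hasDerivAt_const x (0 : ℝ))
  intro r hr
  filter_upwards [hf (r / a) ((lt_div_iff₀' ha).mpr hr)] with z hz
  have slope_mul : slope (fun z => a * f z) x z = a * slope f x z := by
    simp only [slope_def_field]
    ring
  rwa [slope_mul, ← lt_div_iff₀' ha]

theorem DiniDerivLE.comp_mul_add {a b : ℝ} (ha : 0 ≤ a) (hf : DiniDerivLE f c (a * x + b)) :
    DiniDerivLE (fun z => f (a * z + b)) (a * c) x := by
  rcases ha.eq_or_lt with rfl | ha
  · simpa using diniDerivLE_of_hasDerivAt (hasDerivAt_const x (f b))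
  intro r hr
  have scale : Tendsto (fun z => a * z + b) (𝓝[>] x) (𝓝[>] (a * x + b)) :=
    ContinuousWithinAt.tendsto_nhdsWithin (by fun_prop) fun z (hz : x < z) => by
      rw [mem_Ioi]
      gcongr
  filter_upwards [scale.eventually (hf (r / a) ((lt_div_iff₀' ha).mpr hr))] with z hz
  have slope_comp :
      slope (fun z => f (a * z + b)) x z = a * slope f (a * x + b) (a * z + b) := by
    rw [slope_def_field, slope_def_field, add_sub_add_right_eq_sub, ← mul_sub, mul_div_assoc',
      mul_div_mul_left _ _ ha.ne']
  rwa [slope_comp, ← lt_div_iff₀' ha]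

theorem DiniDerivLE.le_mul_exp {a b K : ℝ} (hab : a ≤ b) (hf : ContinuousOn f (Icc a b))
    (hfK : ∀ x ∈ Ico a b, DiniDerivLE f (K * f x) x) :
    f b ≤ f a * Real.exp (K * (b - a)) := by
  have h := le_gronwallBound_of_liminf_deriv_right_le (ε := 0) hf
    (fun x hx r hr => (hfK x hx r hr).frequently) le_rfl (fun x _ => (add_zero _).ge) b
    (right_mem_Icc.mpr hab)
  rwa [gronwallBound_ε0] at h

variable {E : Type*} [NormedAddCommGroup E] [NormedSpace ℝ E]

theorem DiniDerivLE.norm_of_hasDerivAt {y : ℝ → E} {y' : E} (hy : HasDerivAt y y' x)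
    (hc : DiniDerivLE (fun h => ‖y x + h • y'‖) c 0) : DiniDerivLE (fun z => ‖y z‖) c x := by
  have tangent : DiniDerivLE (fun z => ‖y x + (z - x) • y'‖) c x := by
    simpa [sub_eq_add_neg] using comp_mul_add (a := 1) (b := -x) (x := x) zero_le_one
      (by simpa using hc)
  have remainder : HasDerivAt (fun z => ‖y z - y x - (z - x) • y'‖) 0 x := by
    rw [hasDerivAt_iff_isLittleO] at hy ⊢
    simpa using hy.norm_left
  have h := tangent.add (diniDerivLE_of_hasDerivAt remainder)
  rw [add_zero] at h
  refine h.of_le (.of_forall fun z => ?_) (by simp)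
  refine (norm_add_le _ _).trans_eq' ?_
  congr 1
  abel

end Dini

section Dissipative

variable {E : Type*} [NormedAddCommGroup E] [NormedSpace ℂ E]

/-- The operator `A` is dissipative: each `x + h A x` has norm at most `‖x‖ + o(h)` as `h ↓ 0`.
This makes norms non-increasing along the solutions of `y' = A y`. -/
def Dissipative (A : E →L[ℂ] E) : Prop :=
  ∀ x, DiniDerivLE (fun h => ‖x + h • A x‖) 0 0

variable {A B : E →L[ℂ] E}

theorem dissipative_of_sq_bound
    (hA : ∀ x, ∃ c, ∀ h > 0, ‖x + (h : ℝ) • A x‖ ≤ ‖x‖ + h ^ 2 * c) : Dissipative A := fun x => by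
  obtain ⟨c, hc⟩ := hA x
  have deriv_bound : HasDerivAt (fun h : ℝ => ‖x‖ + h ^ 2 * c) 0 0 := by
    simpa using ((hasDerivAt_pow 2 (0 : ℝ)).mul_const c).const_add ‖x‖
  refine (diniDerivLE_of_hasDerivAt deriv_bound).of_le (eventually_mem_nhdsWithin.mono hc) ?_
  simp

theorem dissipative_zero : Dissipative (0 : E →L[ℂ] E) :=
  dissipative_of_sq_bound fun x => ⟨0, by simp⟩

theorem Dissipative.smul {a : ℝ} (ha : 0 ≤ a) (hA : Dissipative A) :
    Dissipative ((a : ℂ) • A) := fun x => by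
  have h := DiniDerivLE.comp_mul_add (b := 0) (x := 0) ha (by simpa using hA x)
  simpa [mul_smul, mul_comm a] using h

theorem Dissipative.add (hA : Dissipative A) (hB : Dissipative B) : Dissipative (A + B) :=
  fun x => by
  have two_mul_zero {f : ℝ → ℝ} (hf : DiniDerivLE f 0 0) :
      DiniDerivLE (fun h => 1 / 2 * f (2 * h)) 0 0 := by
    simpa using (DiniDerivLE.comp_mul_add (b := 0) (x := 0) zero_le_two
      (by simpa using hf)).const_mul one_half_pos.le
  have h := (two_mul_zero (hA x)).add (two_mul_zero (hB x))
  rw [add_zero] at h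
  refine h.of_le (.of_forall fun z => ?_) (by simp [← two_mul])
  calc ‖x + z • (A + B) x‖
      = ‖(1 / 2 : ℝ) • (x + (2 * z) • A x) + (1 / 2 : ℝ) • (x + (2 * z) • B x)‖ := by
        rw [add_apply]; congr 1; module
    _ ≤ _ := (norm_add_le _ _).trans_eq (by simp only [norm_smul]; norm_num)

theorem Dissipative.sum {ι : Type*} {A : ι → E →L[ℂ] E} (s : Finset ι)
    (hA : ∀ i ∈ s, Dissipative (A i)) : Dissipative (∑ i ∈ s, A i) :=
  Finset.sum_induction A Dissipative (fun _ _ => Dissipative.add) dissipative_zero hA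

theorem Dissipative.diniDerivLE_norm {y : ℝ → E} {r : E} {x : ℝ} (hA : Dissipative A)
    (hy : HasDerivAt y (A (y x) + r) x) : DiniDerivLE (fun z => ‖y z‖) ‖r‖ x := by
  have h := (hA (y x)).add (diniDerivLE_of_hasDerivAt (hasDerivAt_mul_const ‖r‖))
  rw [zero_add] at h
  refine .norm_of_hasDerivAt hy (h.of_le ?_ (by simp))
  filter_upwards [self_mem_nhdsWithin] with z (hz : 0 < z)
  calc ‖y x + z • (A (y x) + r)‖ = ‖(y x + z • A (y x)) + z • r‖ := by rw [smul_add, add_assoc]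
    _ ≤ ‖y x + z • A (y x)‖ + z * ‖r‖ := by
      refine (norm_add_le _ _).trans_eq ?_
      rw [norm_smul, Real.norm_of_nonneg hz.le]

theorem antitone_norm_of_hasDerivAt_dissipative {A : ℝ → E →L[ℂ] E} (hA : ∀ u, Dissipative (A u))
    {y : ℝ → E} (hy : ∀ u, HasDerivAt y (A u (y u)) u) : Antitone fun u => ‖y u‖ :=
  fun a b hab => by
  have hcont : Continuous y := continuous_iff_continuousAt.mpr fun u => (hy u).continuousAt
  have h := DiniDerivLE.le_mul_exp (K := 0) hab hcont.norm.continuousOn fun u _ => by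
    simpa using (hA u).diniDerivLE_norm (r := 0) (by simpa using hy u)
  simpa using h

end Dissipative

section Propagators

variable {E : Type*} [NormedAddCommGroup E] [NormedSpace ℂ E] [CompleteSpace E]
  {L A D : ℝ → E →L[ℂ] E}

theorem hasDerivAt_timeOrderedExp_apply_sub (hL : Continuous L) (t : ℝ) (x : E) (u : ℝ) :
    HasDerivAt (fun u => timeOrderedExp L t (t - u) x)
      (L (t - u) (timeOrderedExp L t (t - u) x)) u := by
  have h := (hasDerivAt_timeOrderedExp_left hL t (t - u)).scomp u ((hasDerivAt_id u).const_sub t)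
  exact (((ContinuousLinearMap.apply ℂ E x).restrictScalars ℝ).hasFDerivAt.comp_hasDerivAt u
    h).congr_deriv (by simp)

theorem norm_timeOrderedExp_apply_le (hL : Continuous L) (hdiss : ∀ τ, Dissipative (L τ)) {s t : ℝ}
    (hst : s ≤ t) (x : E) : ‖timeOrderedExp L t s x‖ ≤ ‖x‖ := by
  simpa [timeOrderedExp_self] using
    antitone_norm_of_hasDerivAt_dissipative (fun u => hdiss (t - u))
      (hasDerivAt_timeOrderedExp_apply_sub hL t x) (sub_nonneg.mpr hst)

theorem norm_timeOrderedExp_add_sub_le (hA : Continuous A) (hD : Continuous D)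
    (hdiss : ∀ τ, Dissipative (A τ + D τ)) {s t M : ℝ} (hst : s ≤ t) (x : E)
    (hM : ∀ τ ∈ Ico s t, ‖D τ (timeOrderedExp A t τ x)‖ ≤ M) :
    ‖timeOrderedExp (fun τ => A τ + D τ) t s x - timeOrderedExp A t s x‖ ≤ M * (t - s) := by
  set V₁ := fun τ => timeOrderedExp (fun τ => A τ + D τ) τ s
  set V₀ := fun τ => timeOrderedExp A t τ
  have hAD : Continuous fun τ => A τ + D τ := hA.add hD
  have duhamel (τ : ℝ) : HasDerivAt (fun τ => V₁ τ (V₀ τ x)) (V₁ τ (D τ (V₀ τ x))) τ := by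
    have hprod : HasDerivAt (fun τ => V₁ τ * V₀ τ) (V₁ τ * D τ * V₀ τ) τ :=
      ((hasDerivAt_timeOrderedExp hAD s τ).fun_mul
        (hasDerivAt_timeOrderedExp_left hA t τ)).congr_deriv (by noncomm_ring)
    exact ((ContinuousLinearMap.apply ℂ E x).restrictScalars ℝ).hasFDerivAt.comp_hasDerivAt τ hprod
  have h := norm_image_sub_le_of_norm_deriv_le_segment' (fun τ _ => (duhamel τ).hasDerivWithinAt)
    (fun τ hτ => (norm_timeOrderedExp_apply_le hAD hdiss hτ.1 _).trans (hM τ hτ)) t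
    (right_mem_Icc.mpr hst)
  simpa [V₁, V₀, timeOrderedExp_self] using h

end Propagators

section Kraus

open Matrix

variable {m n ι : Type*} [Fintype m] [DecidableEq m] [Fintype n] [DecidableEq n] [Fintype ι]

theorem norm_one_kronecker_le [DecidableEq ι] (X : Matrix m m ℂ) :
    ‖(1 : Matrix ι ι ℂ) ⊗ₖ X‖ ≤ ‖X‖ := by
  let φ : Matrix m m ℂ →⋆ₐ[ℂ] Matrix (ι × m) (ι × m) ℂ :=
    { (kroneckerAlgEquiv ι m ℂ).toAlgHom.comp Algebra.TensorProduct.includeRight with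
      map_star' := fun X => by simp [star_eq_conjTranspose, conjTranspose_kronecker] }
  have hφ : φ X = 1 ⊗ₖ X := kroneckerLinearEquiv_tmul ..
  rw [← hφ]
  exact NonUnitalStarAlgHom.norm_apply_le (φ : Matrix m m ℂ →⋆ₙₐ[ℂ] Matrix (ι × m) (ι × m) ℂ) X

-- Stinespring dilation: the completely positive map is `X ↦ V† (1 ⊗ X) V`, where the column `V`
-- stacks the `K i`.
theorem norm_sum_conjTranspose_mul_mul_le (K : ι → Matrix m n ℂ) (X : Matrix m m ℂ) :
    ‖∑ i, (K i).conjTranspose * X * K i‖ ≤ ‖∑ i, (K i).conjTranspose * K i‖ * ‖X‖ := by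
  classical
  let V : Matrix (ι × m) n ℂ := of fun p j => K p.1 p.2 j
  have dilate (Y : Matrix m m ℂ) :
      V.conjTranspose * ((1 : Matrix ι ι ℂ) ⊗ₖ Y) * V = ∑ i, (K i).conjTranspose * Y * K i := by
    ext j l
    simp [V, mul_apply, Matrix.sum_apply, Finset.sum_mul, Fintype.sum_prod_type, one_apply]
  have norm_V_sq : ‖V.conjTranspose‖ * ‖V‖ = ‖∑ i, (K i).conjTranspose * K i‖ := by
    rw [l2_opNorm_conjTranspose, ← l2_opNorm_conjTranspose_mul_self]
    simpa using congrArg norm (dilate 1)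
  calc ‖∑ i, (K i).conjTranspose * X * K i‖
      = ‖V.conjTranspose * ((1 : Matrix ι ι ℂ) ⊗ₖ X) * V‖ := by rw [dilate]
    _ ≤ ‖V.conjTranspose‖ * ‖X‖ * ‖V‖ := by
      refine (l2_opNorm_mul _ _).trans ?_
      gcongr
      refine (l2_opNorm_mul _ _).trans ?_
      gcongr
      exact norm_one_kronecker_le X
    _ = ‖∑ i, (K i).conjTranspose * K i‖ * ‖X‖ := by rw [← norm_V_sq]; ring

-- Up to an error `O(h²)`, the Euler step `X ↦ X + h T X` is the completely positive map with Kraus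
-- operators `1 - h M` and `√h K j`.
theorem dissipative_of_kraus {T : Matrix n n ℂ →L[ℂ] Matrix n n ℂ} {K : ι → Matrix n n ℂ}
    {M : Matrix n n ℂ} (hM : M + M.conjTranspose = ∑ j, (K j).conjTranspose * K j)
    (hT : ∀ X, T X = ∑ j, (K j).conjTranspose * X * K j - M.conjTranspose * X - X * M) :
    Dissipative T := by
  refine dissipative_of_sq_bound fun X =>
    ⟨‖M.conjTranspose * M‖ * ‖X‖ + ‖M.conjTranspose * X * M‖, fun h hh => ?_⟩
  let K' : Option ι → Matrix n n ℂ := fun o => o.elim (1 - h • M) fun j => √h • K j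
  have sum_K' (Y : Matrix n n ℂ) : ∑ o, (K' o).conjTranspose * Y * K' o =
      (1 - h • M.conjTranspose) * Y * (1 - h • M)
        + h • ∑ j, (K j).conjTranspose * Y * K j := by
    simp [K', Fintype.sum_option, Finset.smul_sum, smul_smul, Real.mul_self_sqrt hh.le]
  have sum_K'_one : ∑ o, (K' o).conjTranspose * K' o = 1 + h ^ 2 • (M.conjTranspose * M) := by
    have unit := sum_K' 1
    simp only [Matrix.mul_one, ← hM] at unit
    rw [unit]
    simp only [mul_sub, sub_mul, Matrix.mul_one, Matrix.one_mul, smul_mul_assoc, mul_smul_comm]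
    module
  have euler_step_eq : X + h • T X =
      ∑ o, (K' o).conjTranspose * X * K' o - h ^ 2 • (M.conjTranspose * X * M) := by
    rw [sum_K', hT]
    simp only [mul_sub, sub_mul, Matrix.mul_one, Matrix.one_mul, smul_mul_assoc, mul_smul_comm]
    module
  have norm_sum_K' : ‖∑ o, (K' o).conjTranspose * K' o‖ ≤ 1 + h ^ 2 * ‖M.conjTranspose * M‖ := by
    rw [sum_K'_one]
    refine (norm_add_le _ _).trans <| add_le_add (IsStarProjection.one _).norm_le ?_
    rw [norm_smul, Real.norm_of_nonneg (sq_nonneg h)]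
  calc ‖X + h • T X‖
      ≤ ‖∑ o, (K' o).conjTranspose * X * K' o‖ + h ^ 2 * ‖M.conjTranspose * X * M‖ := by
        rw [euler_step_eq]
        refine (norm_sub_le _ _).trans_eq ?_
        rw [norm_smul, Real.norm_of_nonneg (sq_nonneg h)]
    _ ≤ (1 + h ^ 2 * ‖M.conjTranspose * M‖) * ‖X‖ + h ^ 2 * ‖M.conjTranspose * X * M‖ := by
        gcongr
        exact (norm_sum_conjTranspose_mul_mul_le K' X).trans (by gcongr)
    _ = ‖X‖ + h ^ 2 * (‖M.conjTranspose * M‖ * ‖X‖ + ‖M.conjTranspose * X * M‖) := by ring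

end Kraus

section Superoperators

variable {N q : ℕ}

@[simp]
theorem mulLeft_apply (A X : Op N q) : mulLeft A X = A * X := rfl

@[simp]
theorem mulRight_apply (A X : Op N q) : mulRight A X = X * A := rfl

end Superoperators

section LocalOperators

variable {N q : ℕ} {S T : Finset (Fin N)} {A B : Op N q}

/-- The operator `a ⊗ 1` of the chain, for an operator `a` on the sites in `S`. -/
def embed (S : Finset (Fin N)) : Matrix (S → Fin q) (S → Fin q) ℂ →⋆ₐ[ℂ] Op N q where
  toFun a := (a ⊗ₖ (1 : Matrix ({k // k ∉ S} → Fin q) ({k // k ∉ S} → Fin q) ℂ)).submatrix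
    (Equiv.piEquivPiSubtypeProd (· ∈ S) fun _ => Fin q)
    (Equiv.piEquivPiSubtypeProd (· ∈ S) fun _ => Fin q)
  map_one' := by simp
  map_mul' a b := by simp [Matrix.submatrix_mul_equiv, ← Matrix.mul_kronecker_mul]
  map_zero' := by simp
  map_add' a b := by rw [Matrix.add_kronecker, Matrix.submatrix_add]; rfl
  commutes' c := by
    simp only [Algebra.algebraMap_eq_smul_one, Matrix.smul_kronecker, Matrix.submatrix_smul]
    simp
  map_star' a := by
    simp [Matrix.star_eq_conjTranspose, Matrix.conjTranspose_kronecker]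

theorem embed_apply (S : Finset (Fin N)) (a : Matrix (S → Fin q) (S → Fin q) ℂ)
    (σ τ : Fin N → Fin q) :
    embed S a σ τ = if ∀ k, k ∉ S → σ k = τ k then a (fun k => σ k) (fun k => τ k) else 0 := by
  simp [embed, Matrix.one_apply, Equiv.piEquivPiSubtypeProd, funext_iff]

theorem supportedOn_iff_exists_embed_eq : SupportedOn S A ↔ ∃ a, embed S a = A := by
  simp only [SupportedOn, ← Matrix.ext_iff, embed_apply, eq_comm]

theorem SupportedOn.mono (hST : S ⊆ T) (hA : SupportedOn S A) : SupportedOn T A := by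
  obtain ⟨a, ha⟩ := hA
  refine ⟨Matrix.of fun α β => if ∀ k : T, (k : Fin N) ∉ S → α k = β k then
    a (fun k => α ⟨k, hST k.2⟩) (fun k => β ⟨k, hST k.2⟩) else 0, fun σ τ => ?_⟩
  have agree_iff : (∀ k, k ∉ S → σ k = τ k) ↔
      (∀ k, k ∉ T → σ k = τ k) ∧ ∀ k : T, (k : Fin N) ∉ S → σ k = τ k :=
    ⟨fun h => ⟨fun k hk => h k (mt (@hST k) hk), fun k => h k⟩,
      fun h k hk => if hT : k ∈ T then h.2 ⟨k, hT⟩ hk else h.1 k hT⟩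
  rw [ha, Matrix.of_apply, ← ite_and]
  exact if_congr agree_iff rfl rfl

theorem SupportedOn.conjTranspose (hA : SupportedOn S A) : SupportedOn S A.conjTranspose := by
  rw [supportedOn_iff_exists_embed_eq] at hA ⊢
  obtain ⟨a, rfl⟩ := hA
  exact ⟨star a, map_star _ _⟩

theorem SupportedOn.exists_eq_one_kronecker (hB : SupportedOn T B) (hST : Disjoint S T) :
    ∃ b, B = ((1 : Matrix (S → Fin q) (S → Fin q) ℂ) ⊗ₖ b).submatrix
      (Equiv.piEquivPiSubtypeProd (· ∈ S) fun _ => Fin q)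
      (Equiv.piEquivPiSubtypeProd (· ∈ S) fun _ => Fin q) := by
  obtain ⟨b, hb⟩ := hB.mono (Finset.subset_compl_iff_disjoint_left.mpr hST)
  refine ⟨b.submatrix (fun β k => β ⟨k, Finset.mem_compl.mp k.2⟩)
    (fun β k => β ⟨k, Finset.mem_compl.mp k.2⟩), ?_⟩
  ext σ τ
  simp [hb, Matrix.one_apply, Equiv.piEquivPiSubtypeProd, funext_iff]

theorem SupportedOn.commute (hST : Disjoint S T) (hA : SupportedOn S A) (hB : SupportedOn T B) :
    Commute A B := by
  obtain ⟨a, rfl⟩ := supportedOn_iff_exists_embed_eq.mp hA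
  obtain ⟨b, rfl⟩ := hB.exists_eq_one_kronecker hST
  simp [commute_iff_eq, embed, Matrix.submatrix_mul_equiv, ← Matrix.mul_kronecker_mul]

/-- The matrix unit `|α⟩⟨β|` on the sites in `S`, tensored with the identity on the other sites. -/
def matUnit (S : Finset (Fin N)) (α β : S → Fin q) : Op N q := embed S (Matrix.single α β 1)

theorem supportedOn_matUnit (S : Finset (Fin N)) (α β : S → Fin q) :
    SupportedOn S (matUnit S α β) :=
  supportedOn_iff_exists_embed_eq.mpr ⟨_, rfl⟩

theorem matUnit_mul_matUnit (S : Finset (Fin N)) (α β γ δ : S → Fin q) :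
    matUnit S α β * matUnit S γ δ = if β = γ then matUnit S α δ else 0 := by
  rw [matUnit, matUnit, ← map_mul]
  split_ifs with h
  · simp [h, matUnit]
  · simp [h]

theorem conjTranspose_matUnit (S : Finset (Fin N)) (α β : S → Fin q) :
    (matUnit S α β).conjTranspose = matUnit S β α := by
  rw [matUnit, ← Matrix.star_eq_conjTranspose, ← map_star, Matrix.star_eq_conjTranspose,
    Matrix.conjTranspose_single, star_one, matUnit]

theorem embed_eq_sum_matUnit (S : Finset (Fin N)) (a : Matrix (S → Fin q) (S → Fin q) ℂ) :
    embed S a = ∑ α, ∑ β, a α β • matUnit S α β := by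
  conv_lhs => rw [Matrix.matrix_eq_sum_single a]
  simp only [matUnit, map_sum, ← map_smul, Matrix.smul_single, smul_eq_mul, mul_one]

theorem sum_matUnit_mul_matUnit (S : Finset (Fin N)) :
    ∑ p : (S → Fin q) × (S → Fin q), matUnit S p.2 p.1 * matUnit S p.1 p.2
      = (Fintype.card (S → Fin q) : ℂ) • (1 : Op N q) := by
  have sum_diag : ∑ α : S → Fin q, matUnit S α α = 1 := by
    simpa [Matrix.one_apply] using (embed_eq_sum_matUnit S (1 : Matrix (S → Fin q) _ ℂ)).symm
  simp only [matUnit_mul_matUnit, if_true, Fintype.sum_prod_type, sum_diag, Finset.sum_const,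
    Finset.card_univ, Nat.cast_smul_eq_nsmul]

end LocalOperators

section SiteAverage

variable {N q : ℕ} {S T : Finset (Fin N)} {A : Op N q}

/-- The conditional expectation onto the operators that act trivially on the sites in `S`,
written as a sum over the matrix units `|α⟩⟨β|` on `S`. -/
noncomputable def siteAverage (S : Finset (Fin N)) : SuperOp N q :=
  (Fintype.card (S → Fin q) : ℂ)⁻¹ •
    ∑ p : (S → Fin q) × (S → Fin q), mulLeft (matUnit S p.2 p.1) * mulRight (matUnit S p.1 p.2)

theorem siteAverage_apply (S : Finset (Fin N)) (X : Op N q) :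
    siteAverage S X = (Fintype.card (S → Fin q) : ℂ)⁻¹ •
      ∑ p : (S → Fin q) × (S → Fin q), matUnit S p.2 p.1 * X * matUnit S p.1 p.2 := by
  simp [siteAverage, mul_assoc]

theorem norm_siteAverage_apply_le (S : Finset (Fin N)) (X : Op N q) :
    ‖siteAverage S X‖ ≤ ‖X‖ := by
  have kraus := norm_sum_conjTranspose_mul_mul_le
    (fun p : (S → Fin q) × (S → Fin q) => matUnit S p.1 p.2) X
  simp only [conjTranspose_matUnit, sum_matUnit_mul_matUnit, norm_smul] at kraus
  set d : ℂ := (Fintype.card (S → Fin q) : ℂ)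
  calc ‖siteAverage S X‖ ≤ ‖d‖⁻¹ * (‖d‖ * ‖(1 : Op N q)‖ * ‖X‖) := by
        rw [siteAverage_apply, norm_smul, norm_inv]
        gcongr
    _ = (‖d‖⁻¹ * ‖d‖) * (‖(1 : Op N q)‖ * ‖X‖) := by ring
    _ ≤ 1 * (1 * ‖X‖) := by
        gcongr
        exacts [inv_mul_le_one, (IsStarProjection.one _).norm_le]
    _ = ‖X‖ := by rw [one_mul, one_mul]

theorem matUnit_commute_siteAverage (S : Finset (Fin N)) (γ δ : S → Fin q) (X : Op N q) :
    Commute (matUnit S γ δ) (siteAverage S X) := by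
  have left_mul (p : (S → Fin q) × (S → Fin q)) :
      matUnit S γ δ * (matUnit S p.2 p.1 * X * matUnit S p.1 p.2)
        = if δ = p.2 then matUnit S γ p.1 * X * matUnit S p.1 p.2 else 0 := by
    rw [← mul_assoc, ← mul_assoc, matUnit_mul_matUnit, ite_mul, ite_mul, zero_mul, zero_mul]
  have right_mul (p : (S → Fin q) × (S → Fin q)) :
      matUnit S p.2 p.1 * X * matUnit S p.1 p.2 * matUnit S γ δ
        = if p.2 = γ then matUnit S p.2 p.1 * X * matUnit S p.1 δ else 0 := by
    rw [mul_assoc _ (matUnit S p.1 p.2), matUnit_mul_matUnit, mul_ite, mul_zero]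
  rw [siteAverage_apply]
  refine Commute.smul_right ?_ _
  simp only [commute_iff_eq, Finset.mul_sum, Finset.sum_mul, left_mul, right_mul]
  simp [Fintype.sum_prod_type]

theorem SupportedOn.commute_siteAverage (hA : SupportedOn S A) (X : Op N q) :
    Commute A (siteAverage S X) := by
  obtain ⟨a, rfl⟩ := supportedOn_iff_exists_embed_eq.mp hA
  rw [embed_eq_sum_matUnit]
  exact .sum_left _ _ _ fun α _ => .sum_left _ _ _ fun β _ =>
    (matUnit_commute_siteAverage S α β X).smul_left _

theorem siteAverage_mul_left (hST : Disjoint S T) (hA : SupportedOn T A) (X : Op N q) :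
    siteAverage S (A * X) = A * siteAverage S X := by
  have comm (p : (S → Fin q) × (S → Fin q)) :
      matUnit S p.2 p.1 * (A * X) = A * (matUnit S p.2 p.1 * X) :=
    ((supportedOn_matUnit S p.2 p.1).commute hST hA).left_comm X
  simp only [siteAverage_apply, comm, mul_smul_comm, Finset.mul_sum, mul_assoc]

theorem siteAverage_mul_right (hST : Disjoint S T) (hA : SupportedOn T A) (X : Op N q) :
    siteAverage S (X * A) = siteAverage S X * A := by
  have comm (p : (S → Fin q) × (S → Fin q)) : A * matUnit S p.1 p.2 = matUnit S p.1 p.2 * A :=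
    ((supportedOn_matUnit S p.1 p.2).commute hST hA).symm
  simp only [siteAverage_apply, comm, smul_mul_assoc, Finset.sum_mul, mul_assoc]

theorem siteAverage_one (S : Finset (Fin N)) : siteAverage S (1 : Op N q) = 1 := by
  cases isEmpty_or_nonempty (S → Fin q) with
  | inl h =>
    have : IsEmpty (Fin N → Fin q) := ⟨fun σ => h.false fun k => σ k⟩
    exact Subsingleton.elim _ _
  | inr h =>
    rw [siteAverage_apply]
    simp only [mul_one, sum_matUnit_mul_matUnit]
    exact inv_smul_smul₀ (Nat.cast_ne_zero.mpr Fintype.card_ne_zero) _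

theorem siteAverage_eq_self (hST : Disjoint S T) (hA : SupportedOn T A) : siteAverage S A = A := by
  simpa [siteAverage_one] using siteAverage_mul_left hST hA 1

end SiteAverage

section LocalLindbladians

variable {N q : ℕ} {S S' : Finset (Fin N)} {T : SuperOp N q} {A : Op N q}

/-- `T` is an adjoint Lindbladian that acts only on the sites in `S`, in the standard form
`X ↦ ∑ⱼ Kⱼ† X Kⱼ - M† X - X M`. A Hamiltonian `H` and Lindblad operators `Lⱼ` correspond to
`Kⱼ = Lⱼ` and `M = i H + ∑ⱼ Lⱼ† Lⱼ / 2`; the condition on `M + M†` says that `T 1 = 0`. -/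
def IsLocalLindbladian (S : Finset (Fin N)) (T : SuperOp N q) : Prop :=
  ∃ (m : ℕ) (K : Fin m → Op N q) (M : Op N q), (∀ j, SupportedOn S (K j)) ∧ SupportedOn S M ∧
    M + M.conjTranspose = ∑ j, (K j).conjTranspose * K j ∧
    ∀ X, T X = ∑ j, (K j).conjTranspose * X * K j - M.conjTranspose * X - X * M

theorem IsLocalHamiltonianLiouvillian.isLocalLindbladian (hT : IsLocalHamiltonianLiouvillian S T) :
    IsLocalLindbladian S T := by
  obtain ⟨H, hH, hS, rfl⟩ := hT
  obtain ⟨a, rfl⟩ := supportedOn_iff_exists_embed_eq.mp hS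
  refine ⟨0, Fin.elim0, Complex.I • embed S a, fun j => j.elim0,
    supportedOn_iff_exists_embed_eq.mpr ⟨Complex.I • a, map_smul _ _ _⟩, ?_, fun X => ?_⟩
  · simp [Matrix.conjTranspose_smul, hH.eq]
  · simp [hamiltonianPart, Matrix.conjTranspose_smul, hH.eq, smul_sub]

theorem IsSiteDissipator.isLocalLindbladian {k : Fin N} (hT : IsSiteDissipator k T) :
    IsLocalLindbladian {k} T := by
  obtain ⟨m, L, hL, rfl⟩ := hT
  choose l hl using fun j => supportedOn_iff_exists_embed_eq.mp (hL j)
  set M : Op N q := (1 / 2 : ℂ) • ∑ j, (L j).conjTranspose * L j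
  have supported_M : SupportedOn {k} M :=
    supportedOn_iff_exists_embed_eq.mpr ⟨(1 / 2 : ℂ) • ∑ j, star (l j) * l j, by
      simp only [M, map_smul, map_sum, map_mul, map_star, hl]
      rfl⟩
  have conjTranspose_M : M.conjTranspose = M := by
    simp [M, Matrix.conjTranspose_smul, Matrix.conjTranspose_sum]
  refine ⟨m, L, M, hL, supported_M, ?_, fun X => ?_⟩
  · rw [conjTranspose_M, ← add_smul, add_halves, one_smul]
  · rw [conjTranspose_M]
    simp only [dissipator, M, sum_apply, Finset.mul_sum, Finset.sum_mul,
      smul_mul_assoc, mul_smul_comm, Finset.smul_sum, ← Finset.sum_sub_distrib]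
    refine Finset.sum_congr rfl fun j _ => ?_
    simp only [one_div, smul_sub, ne_eq, OfNat.ofNat_ne_zero, not_false_eq_true, inv_smul_smul₀,
      sub_apply, mul_apply_eq_comp, mulRight_apply, mulLeft_apply, smul_apply, mul_assoc]
    abel

theorem IsLocalLindbladian.mono (hSS' : S ⊆ S') (hT : IsLocalLindbladian S T) :
    IsLocalLindbladian S' T := by
  obtain ⟨m, K, M, hK, hM, hKM, hT⟩ := hT
  exact ⟨m, K, M, fun j => (hK j).mono hSS', hM.mono hSS', hKM, hT⟩

theorem IsLocalLindbladian.dissipative (hT : IsLocalLindbladian S T) : Dissipative T := by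
  obtain ⟨m, K, M, -, -, hKM, hT⟩ := hT
  exact dissipative_of_kraus hKM hT

theorem IsLocalLindbladian.apply_siteAverage_eq_zero (hT : IsLocalLindbladian S T) (X : Op N q) :
    T (siteAverage S X) = 0 := by
  obtain ⟨m, K, M, hK, hM, hKM, hT⟩ := hT
  have comm {A : Op N q} (hA : SupportedOn S A) : A * siteAverage S X = siteAverage S X * A :=
    hA.commute_siteAverage X
  simp only [hT, comm hM.conjTranspose, comm (hK _).conjTranspose, mul_assoc, ← Finset.mul_sum,
    ← hKM, ← mul_sub, add_sub_cancel_right, sub_self]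

theorem IsLocalLindbladian.siteAverage_apply_comm (hS : Disjoint S' S) (hT : IsLocalLindbladian S T)
    (X : Op N q) : siteAverage S' (T X) = T (siteAverage S' X) := by
  obtain ⟨m, K, M, hK, hM, -, hT⟩ := hT
  simp only [hT, map_sub, map_sum, siteAverage_mul_left hS hM.conjTranspose,
    siteAverage_mul_left hS (hK _).conjTranspose, siteAverage_mul_right hS hM,
    siteAverage_mul_right hS (hK _)]

/-- The part of an operator that acts nontrivially on the sites in `S`; its norm measures how far
an evolved operator has spread into `S`. -/
noncomputable def fluctuation (S : Finset (Fin N)) : SuperOp N q := 1 - siteAverage S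

theorem fluctuation_apply (S : Finset (Fin N)) (X : Op N q) :
    fluctuation S X = X - siteAverage S X := rfl

theorem norm_fluctuation_apply_le (S : Finset (Fin N)) (X : Op N q) :
    ‖fluctuation S X‖ ≤ 2 * ‖X‖ := by
  rw [fluctuation_apply]
  linarith [norm_sub_le X (siteAverage S X), norm_siteAverage_apply_le S X]

theorem fluctuation_eq_zero (hS : Disjoint S S') (hA : SupportedOn S' A) : fluctuation S A = 0 := by
  rw [fluctuation_apply, siteAverage_eq_self hS hA, sub_self]

theorem IsLocalLindbladian.apply_fluctuation (hT : IsLocalLindbladian S T) (X : Op N q) :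
    T (fluctuation S X) = T X := by
  rw [fluctuation_apply, map_sub, hT.apply_siteAverage_eq_zero, sub_zero]

theorem IsLocalLindbladian.fluctuation_apply_comm (hS : Disjoint S' S) (hT : IsLocalLindbladian S T)
    (X : Op N q) : fluctuation S' (T X) = T (fluctuation S' X) := by
  rw [fluctuation_apply, fluctuation_apply, map_sub, hT.siteAverage_apply_comm hS]

theorem IsLocalLindbladian.norm_apply_le {J : ℝ} (hT : IsLocalLindbladian S T) (hJ : ‖T‖ ≤ J)
    (X : Op N q) : ‖T X‖ ≤ J * ‖fluctuation S X‖ := by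
  rw [← hT.apply_fluctuation]
  exact T.le_of_opNorm_le hJ _

end LocalLindbladians

section ChainSums

variable {N : ℕ} {m R : ℕ} {i j : Fin N}

theorem mem_nbhd_iff_dist_le : j ∈ nbhd m i ↔ Nat.dist i j ≤ m := by
  simp only [nbhd, Finset.mem_filter_univ, Nat.dist]
  omega

theorem mem_nbhd_comm : j ∈ nbhd m i ↔ i ∈ nbhd m j := by
  rw [mem_nbhd_iff_dist_le, mem_nbhd_iff_dist_le, Nat.dist_comm]

theorem singleton_subset_nbhd (m : ℕ) (i : Fin N) : {i} ⊆ nbhd m i := by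
  simp [mem_nbhd_iff_dist_le]

theorem card_nbhd_le (m : ℕ) (i : Fin N) : (nbhd m i).card ≤ 2 * m + 1 := by
  have maps : Set.MapsTo (fun j : Fin N => (j : ℕ)) (nbhd m i)
      (Finset.Icc (i - m : ℕ) (i + m)) := fun j hj => by
    rw [Finset.mem_coe, nbhd, Finset.mem_filter_univ] at hj
    simp only [Finset.coe_Icc, mem_Icc]
    omega
  calc (nbhd m i).card ≤ (Finset.Icc (i - m : ℕ) (i + m)).card :=
        Finset.card_le_card_of_injOn _ maps Fin.val_injective.injOn
    _ ≤ 2 * m + 1 := by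
        rw [Nat.card_Icc]
        omega

theorem disjoint_nbhd_of_notMem (h : j ∉ nbhd (2 * R) i) : Disjoint (nbhd R i) (nbhd R j) := by
  rw [Finset.disjoint_left]
  intro k hki hkj
  simp only [nbhd, Finset.mem_filter_univ] at h hki hkj
  omega

theorem sum_exp_dist_mul_sum_nbhd_le (m : ℕ) (b : Fin N) {g : Fin N → ℝ} (hg : ∀ i, 0 ≤ g i) :
    ∑ i : Fin N, Real.exp (Nat.dist i b) * ∑ j ∈ nbhd m i, g j
      ≤ (2 * m + 1) * Real.exp m * ∑ j : Fin N, Real.exp (Nat.dist j b) * g j := by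
  have weight_le {i j : Fin N} (hi : i ∈ nbhd m j) :
      Real.exp (Nat.dist i b) ≤ Real.exp m * Real.exp (Nat.dist j b) := by
    rw [← Real.exp_add]
    gcongr
    exact_mod_cast (Nat.dist.triangle_inequality i j b).trans
      (Nat.add_le_add_right (mem_nbhd_iff_dist_le.mp (mem_nbhd_comm.mp hi)) _)
  calc ∑ i : Fin N, Real.exp (Nat.dist i b) * ∑ j ∈ nbhd m i, g j
      = ∑ j : Fin N, ∑ i ∈ nbhd m j, Real.exp (Nat.dist i b) * g j := by
        simp only [Finset.mul_sum]
        exact Finset.sum_comm' fun i j => by simp [mem_nbhd_comm (i := i)]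
    _ ≤ ∑ j : Fin N, ∑ _i ∈ nbhd m j, Real.exp m * Real.exp (Nat.dist j b) * g j := by
        gcongr with j _ _ hi
        exacts [hg j, weight_le hi]
    _ ≤ ∑ j : Fin N, (2 * m + 1) * Real.exp m * (Real.exp (Nat.dist j b) * g j) := by
        gcongr with j
        have card_le : ((nbhd m j).card : ℝ) ≤ 2 * m + 1 := by exact_mod_cast card_nbhd_le m j
        rw [Finset.sum_const, nsmul_eq_mul, mul_assoc (Real.exp m), ← mul_assoc]
        have := hg j
        gcongr
    _ = _ := by rw [Finset.mul_sum]

theorem sum_le_of_exp_dist_weighted_le (m : ℕ) (b : Fin N) {a : Fin N → ℝ} {c W : ℝ}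
    (ha : ∀ i, 0 ≤ a i) (hac : ∀ i, a i ≤ c)
    (hW : ∑ i : Fin N, Real.exp (Nat.dist i b) * a i ≤ W * Real.exp m) :
    ∑ i, a i ≤ (2 * m + 1) * c + W := by
  have inside : ∑ i ∈ nbhd m b, a i ≤ (2 * m + 1) * c := by
    have hc : 0 ≤ c := (ha b).trans (hac b)
    have card_le : ((nbhd m b).card : ℝ) ≤ 2 * m + 1 := by exact_mod_cast card_nbhd_le m b
    calc ∑ i ∈ nbhd m b, a i ≤ (nbhd m b).card * c := by
          simpa using Finset.sum_le_card_nsmul _ _ _ fun i _ => hac i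
      _ ≤ (2 * m + 1) * c := by gcongr
  have outside : ∑ i ∈ (nbhd m b)ᶜ, a i ≤ W := by
    refine le_of_mul_le_mul_left ?_ (Real.exp_pos m)
    calc Real.exp m * ∑ i ∈ (nbhd m b)ᶜ, a i
        = ∑ i ∈ (nbhd m b)ᶜ, Real.exp m * a i := Finset.mul_sum ..
      _ ≤ ∑ i ∈ (nbhd m b)ᶜ, Real.exp (Nat.dist i b) * a i := by
          gcongr with i hi
          · exact ha i
          · rw [Finset.mem_compl, mem_nbhd_comm, mem_nbhd_iff_dist_le, not_le] at hi
            exact hi.le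
      _ ≤ ∑ i : Fin N, Real.exp (Nat.dist i b) * a i :=
          Finset.sum_le_univ_sum_of_nonneg fun i => mul_nonneg (Real.exp_pos _).le (ha i)
      _ ≤ Real.exp m * W := hW.trans_eq (mul_comm _ _)
  rw [← Finset.sum_add_sum_compl (nbhd m b)]
  exact add_le_add inside outside

end ChainSums

section LiebRobinson

variable {N q R : ℕ} {J : ℝ} {b : Fin N} {B : Op N q} {L : Fin N → ℝ → SuperOp N q}
  {y : ℝ → Op N q}

/-- The rate constant of the exponentially weighted Lieb–Robinson bound for interactions of range
`R`: twice the number of sites within distance `2R` of a given one, times the variation `e^{2R}` of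
the weight over that distance. -/
noncomputable def lrConst (R : ℕ) : ℝ := 2 * ((4 * R + 1) * Real.exp (2 * R))

theorem lrConst_nonneg (R : ℕ) : 0 ≤ lrConst R := by
  unfold lrConst
  positivity

theorem sum_exp_dist_mul_sum_nbhd_le_lrConst (R : ℕ) (b : Fin N) {g : Fin N → ℝ}
    (hg : ∀ i, 0 ≤ g i) :
    ∑ i : Fin N, Real.exp (Nat.dist i b) * (2 * ∑ j ∈ nbhd (2 * R) i, g j)
      ≤ lrConst R * ∑ j : Fin N, Real.exp (Nat.dist j b) * g j := by
  have h := sum_exp_dist_mul_sum_nbhd_le (2 * R) b hg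
  push_cast at h
  simp only [mul_left_comm _ (2 : ℝ), ← Finset.mul_sum, lrConst]
  linarith

theorem diniDerivLE_norm_fluctuation (hL : ∀ i u, IsLocalLindbladian (nbhd R i) (L i u))
    (hJ : ∀ i u, ‖L i u‖ ≤ J) (hy : ∀ u, HasDerivAt y ((∑ i, L i u) (y u)) u) (i : Fin N) (u : ℝ) :
    DiniDerivLE (fun v => ‖fluctuation (nbhd R i) (y v)‖)
      (J * (2 * ∑ j ∈ nbhd (2 * R) i, ‖fluctuation (nbhd R j) (y u)‖)) u := by
  set F : SuperOp N q := fluctuation (nbhd R i)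
  set far : SuperOp N q := ∑ j ∈ (nbhd (2 * R) i)ᶜ, L j u
  have far_dissipative : Dissipative far := Dissipative.sum _ fun j _ => (hL j u).dissipative
  have split : F ((∑ j, L j u) (y u)) = far (F (y u)) + ∑ j ∈ nbhd (2 * R) i, F (L j u (y u)) := by
    rw [← Finset.sum_compl_add_sum (nbhd (2 * R) i)]
    simp only [add_apply, sum_apply, map_add, map_sum, far]
    congr 1
    refine Finset.sum_congr rfl fun j hj => (hL j u).fluctuation_apply_comm ?_ _
    exact disjoint_nbhd_of_notMem (Finset.mem_compl.mp hj)
  have deriv_F : HasDerivAt (fun v => F (y v)) (F ((∑ j, L j u) (y u))) u :=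
    (F.restrictScalars ℝ).hasFDerivAt.comp_hasDerivAt u (hy u)
  refine (far_dissipative.diniDerivLE_norm (split ▸ deriv_F)).mono ?_
  calc ‖∑ j ∈ nbhd (2 * R) i, F (L j u (y u))‖
      ≤ ∑ j ∈ nbhd (2 * R) i, 2 * (J * ‖fluctuation (nbhd R j) (y u)‖) :=
        norm_sum_le_of_le _ fun j _ => (norm_fluctuation_apply_le _ _).trans <| by
          gcongr
          exact (hL j u).norm_apply_le (hJ j u) _
    _ = J * (2 * ∑ j ∈ nbhd (2 * R) i, ‖fluctuation (nbhd R j) (y u)‖) := by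
        simp only [Finset.mul_sum, mul_left_comm J]

theorem sum_exp_dist_mul_norm_fluctuation_le (hL : ∀ i u, IsLocalLindbladian (nbhd R i) (L i u))
    (hJ : ∀ i u, ‖L i u‖ ≤ J)
    (hy : ∀ u, HasDerivAt y ((∑ i, L i u) (y u)) u) (b : Fin N) {u : ℝ} (hu : 0 ≤ u) :
    ∑ i : Fin N, Real.exp (Nat.dist i b) * ‖fluctuation (nbhd R i) (y u)‖
      ≤ (∑ i : Fin N, Real.exp (Nat.dist i b) * ‖fluctuation (nbhd R i) (y 0)‖)
        * Real.exp (J * lrConst R * u) := by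
  have hJ₀ : 0 ≤ J := (norm_nonneg _).trans (hJ b 0)
  have dini (v : ℝ) :
      DiniDerivLE (fun w => ∑ i : Fin N, Real.exp (Nat.dist i b) * ‖fluctuation (nbhd R i) (y w)‖)
        (J * lrConst R * ∑ i : Fin N, Real.exp (Nat.dist i b) * ‖fluctuation (nbhd R i) (y v)‖)
        v := by
    refine (DiniDerivLE.sum Finset.univ fun i _ =>
      (diniDerivLE_norm_fluctuation hL hJ hy i v).const_mul (Real.exp_pos _).le).mono ?_
    simp only [mul_left_comm _ J, ← Finset.mul_sum, mul_assoc J]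
    gcongr
    exact sum_exp_dist_mul_sum_nbhd_le_lrConst R b fun i => norm_nonneg _
  have continuous_y : Continuous y := continuous_iff_continuousAt.mpr fun v => (hy v).continuousAt
  simpa using DiniDerivLE.le_mul_exp hu (by fun_prop) fun v _ => dini v

theorem sum_exp_dist_mul_norm_fluctuation_le_of_supportedOn (hB : SupportedOn (nbhd R b) B) :
    ∑ i : Fin N, Real.exp (Nat.dist i b) * ‖fluctuation (nbhd R i) B‖ ≤ lrConst R * ‖B‖ := by
  have far {i : Fin N} (hi : i ∉ nbhd (2 * R) b) : fluctuation (nbhd R i) B = 0 :=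
    fluctuation_eq_zero (disjoint_nbhd_of_notMem hi).symm hB
  have near {i : Fin N} (hi : i ∈ nbhd (2 * R) b) :
      Real.exp (Nat.dist i b) * ‖fluctuation (nbhd R i) B‖
        ≤ Real.exp (2 * R) * (2 * ‖B‖) := by
    gcongr
    · exact_mod_cast mem_nbhd_iff_dist_le.mp (mem_nbhd_comm.mp hi)
    · exact norm_fluctuation_apply_le _ B
  have card_le : ((nbhd (2 * R) b).card : ℝ) ≤ 4 * R + 1 := by
    exact_mod_cast (card_nbhd_le (2 * R) b).trans_eq (by ring)
  calc ∑ i : Fin N, Real.exp (Nat.dist i b) * ‖fluctuation (nbhd R i) B‖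
      = ∑ i ∈ nbhd (2 * R) b, Real.exp (Nat.dist i b) * ‖fluctuation (nbhd R i) B‖ :=
        (Finset.sum_subset (Finset.subset_univ _) fun i _ hi => by
          rw [far hi, norm_zero, mul_zero]).symm
    _ ≤ (nbhd (2 * R) b).card * (Real.exp (2 * R) * (2 * ‖B‖)) := by
        rw [← nsmul_eq_mul]
        exact Finset.sum_le_card_nsmul _ _ _ fun i hi => near hi
    _ ≤ (4 * R + 1) * (Real.exp (2 * R) * (2 * ‖B‖)) := by gcongr
    _ = lrConst R * ‖B‖ := by
        rw [lrConst]
        ring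

-- Each of the `O(J κ u)` sites within distance `J κ u` of `b`, where `κ = lrConst R`, contributes
-- at most `2 ‖y 0‖`; beyond that distance the weight `e^{d(i, b)}` beats the growth `e^{J κ u}`.
theorem sum_norm_fluctuation_le (hL : ∀ i u, IsLocalLindbladian (nbhd R i) (L i u))
    (hJ : ∀ i u, ‖L i u‖ ≤ J) (hy : ∀ u, HasDerivAt y ((∑ i, L i u) (y u)) u)
    (hb : SupportedOn (nbhd R b) (y 0)) {u : ℝ} (hu : 0 ≤ u) :
    ∑ i, ‖fluctuation (nbhd R i) (y u)‖
      ≤ (4 * (J * lrConst R * u) + 6 + lrConst R) * ‖y 0‖ := by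
  have hJ₀ : 0 ≤ J := (norm_nonneg _).trans (hJ b 0)
  have hκ := lrConst_nonneg R
  set radius : ℕ := ⌈J * lrConst R * u⌉₊
  have norm_y_le : ‖y u‖ ≤ ‖y 0‖ :=
    antitone_norm_of_hasDerivAt_dissipative
      (fun v => Dissipative.sum _ fun i _ => (hL i v).dissipative) hy hu
  have weighted : ∑ i : Fin N, Real.exp (Nat.dist i b) * ‖fluctuation (nbhd R i) (y u)‖
      ≤ lrConst R * ‖y 0‖ * Real.exp radius := by
    refine (sum_exp_dist_mul_norm_fluctuation_le hL hJ hy b hu).trans ?_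
    gcongr
    · exact sum_exp_dist_mul_norm_fluctuation_le_of_supportedOn hb
    · exact Nat.le_ceil _
  have radius_le : (radius : ℝ) ≤ J * lrConst R * u + 1 := (Nat.ceil_lt_add_one (by positivity)).le
  calc ∑ i, ‖fluctuation (nbhd R i) (y u)‖
      ≤ (2 * radius + 1) * (2 * ‖y 0‖) + lrConst R * ‖y 0‖ :=
        sum_le_of_exp_dist_weighted_le radius b (fun i => norm_nonneg _)
          (fun i => (norm_fluctuation_apply_le _ _).trans (by gcongr)) weighted
    _ ≤ (2 * (J * lrConst R * u + 1) + 1) * (2 * ‖y 0‖) + lrConst R * ‖y 0‖ := by gcongr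
    _ = (4 * (J * lrConst R * u) + 6 + lrConst R) * ‖y 0‖ := by ring

theorem sum_norm_fluctuation_timeOrderedExp_le (hcont : ∀ i, Continuous (L i))
    (hL : ∀ i τ, IsLocalLindbladian (nbhd R i) (L i τ)) (hJ : ∀ i τ, ‖L i τ‖ ≤ J)
    (hB : SupportedOn (nbhd R b) B) {s t : ℝ} (hst : s ≤ t) :
    ∑ i, ‖fluctuation (nbhd R i) (timeOrderedExp (fun τ => ∑ i, L i τ) t s B)‖
      ≤ (4 * (J * lrConst R * (t - s)) + 6 + lrConst R) * ‖B‖ := by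
  have continuous_sum : Continuous fun τ => ∑ i, L i τ := by fun_prop
  simpa [timeOrderedExp_self] using
    sum_norm_fluctuation_le (L := fun i u => L i (t - u)) (fun i _ => hL i _) (fun i _ => hJ i _)
      (hasDerivAt_timeOrderedExp_apply_sub continuous_sum t B)
      (by simpa [timeOrderedExp_self] using hB) (sub_nonneg.mpr hst)

theorem norm_timeOrderedExp_sub_le {LH LD : Fin N → ℝ → SuperOp N q} {Γ t : ℝ}
    (hLH : ∀ i, Continuous (LH i)) (hLH_loc : ∀ i τ, IsLocalLindbladian (nbhd R i) (LH i τ))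
    (hJ : ∀ i τ, ‖LH i τ‖ ≤ J) (hLD : ∀ k, Continuous (LD k))
    (hLD_loc : ∀ k τ, IsLocalLindbladian (nbhd R k) (LD k τ)) (hLD_le : ∀ k τ, ‖LD k τ‖ ≤ 1)
    (hΓ : 0 ≤ Γ) (hB : SupportedOn (nbhd R b) B) (ht : 0 ≤ t) :
    ‖timeOrderedExp (fun τ => (∑ i, LH i τ) + (Γ : ℂ) • (∑ k, LD k τ)) t 0 B
        - timeOrderedExp (fun τ => ∑ i, LH i τ) t 0 B‖
      ≤ Γ * ((4 * (J * lrConst R * t) + 6 + lrConst R) * ‖B‖) * t := by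
  have hJ₀ : 0 ≤ J := (norm_nonneg _).trans (hJ b 0)
  have hκ := lrConst_nonneg R
  set V₀ : ℝ → SuperOp N q := fun τ => timeOrderedExp (fun τ => ∑ i, LH i τ) t τ
  have continuous_H : Continuous fun τ => ∑ i, LH i τ := by fun_prop
  have continuous_D : Continuous fun τ => (Γ : ℂ) • ∑ k, LD k τ := by fun_prop
  have dissipative (τ : ℝ) : Dissipative ((∑ i, LH i τ) + (Γ : ℂ) • ∑ k, LD k τ) :=
    (Dissipative.sum _ fun i _ => (hLH_loc i τ).dissipative).add
      ((Dissipative.sum _ fun k _ => (hLD_loc k τ).dissipative).smul hΓ)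
  have norm_D_le (τ : ℝ) (hτ : τ ∈ Ico 0 t) : ‖((Γ : ℂ) • ∑ k, LD k τ) (V₀ τ B)‖
      ≤ Γ * ((4 * (J * lrConst R * t) + 6 + lrConst R) * ‖B‖) :=
    calc ‖((Γ : ℂ) • ∑ k, LD k τ) (V₀ τ B)‖ = Γ * ‖∑ k, LD k τ (V₀ τ B)‖ := by
          simp [norm_smul, abs_of_nonneg hΓ]
      _ ≤ Γ * ∑ k, ‖fluctuation (nbhd R k) (V₀ τ B)‖ := by
          gcongr
          exact norm_sum_le_of_le _ fun k _ => by
            simpa using (hLD_loc k τ).norm_apply_le (hLD_le k τ) (V₀ τ B)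
      _ ≤ Γ * ((4 * (J * lrConst R * (t - τ)) + 6 + lrConst R) * ‖B‖) := by
          gcongr
          exact sum_norm_fluctuation_timeOrderedExp_le hLH hLH_loc hJ hB hτ.2.le
      _ ≤ Γ * ((4 * (J * lrConst R * t) + 6 + lrConst R) * ‖B‖) := by
          gcongr
          exact sub_le_self t hτ.1
  simpa using norm_timeOrderedExp_add_sub_le continuous_H continuous_D dissipative ht B norm_D_le

end LiebRobinson

end SpinChain

theorem lemma2_general (R : ℕ) (J t₀ : ℝ) (ht₀ : 0 < t₀) :
    ∃ C : ℝ, ∀ (N q : ℕ) (LH LD : Fin N → ℝ → SpinChain.SuperOp N q) (Γ : ℝ)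
      (b : Fin N) (B : SpinChain.Op N q),
      (∀ i, Continuous (LH i)) →
      (∀ i τ, SpinChain.IsLocalLindbladian (SpinChain.nbhd R i) (LH i τ)) →
      (∀ i τ, ‖LH i τ‖ ≤ J) →
      (∀ k, Continuous (LD k)) →
      (∀ k τ, SpinChain.IsLocalLindbladian (SpinChain.nbhd R k) (LD k τ)) →
      (∀ k τ, ‖LD k τ‖ ≤ 1) →
      0 ≤ Γ →
      SpinChain.SupportedOn (SpinChain.nbhd R b) B →
      ∀ t : ℝ, t₀ ≤ t →
        ‖SpinChain.timeOrderedExp (fun τ => (∑ i, LH i τ) + (Γ : ℂ) • (∑ k, LD k τ)) t 0 B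
          - SpinChain.timeOrderedExp (fun τ => ∑ i, LH i τ) t 0 B‖ ≤ Γ * (C * t ^ 2) * ‖B‖ := by
  refine ⟨4 * J * SpinChain.lrConst R + (6 + SpinChain.lrConst R) / t₀, fun N q LH LD Γ b B hLH
    hLH_loc hJ hLD hLD_loc hLD_le hΓ hB t ht => ?_⟩
  have hκ := SpinChain.lrConst_nonneg R
  have ht_pos : 0 < t := ht₀.trans_le ht
  have absorb : 6 + SpinChain.lrConst R ≤ (6 + SpinChain.lrConst R) / t₀ * t := by
    rw [div_mul_eq_mul_div, le_div_iff₀ ht₀]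
    gcongr
  calc _ ≤ Γ * ((4 * (J * SpinChain.lrConst R * t) + 6 + SpinChain.lrConst R) * ‖B‖) * t :=
        SpinChain.norm_timeOrderedExp_sub_le hLH hLH_loc hJ hLD hLD_loc hLD_le hΓ hB ht_pos.le
    _ = Γ * ((4 * J * SpinChain.lrConst R * t + (6 + SpinChain.lrConst R)) * t) * ‖B‖ := by ring
    _ ≤ Γ * ((4 * J * SpinChain.lrConst R * t + (6 + SpinChain.lrConst R) / t₀ * t) * t) * ‖B‖ := by
        gcongr
    _ = _ := by ring

theorem lemma2 (R : ℕ) (J t₀ : ℝ) (ht₀ : 0 < t₀) :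
    ∃ C : ℝ, ∀ (N q : ℕ) (LH LD : Fin N → ℝ → SpinChain.SuperOp N q) (Γ : ℝ)
      (b : Fin N) (B : SpinChain.Op N q),
      (∀ i, Continuous (LH i)) →
      (∀ i τ, SpinChain.IsLocalHamiltonianLiouvillian (SpinChain.nbhd R i) (LH i τ)) →
      (∀ i τ, ‖LH i τ‖ ≤ J) →
      (∀ k, Continuous (LD k)) →
      (∀ k τ, SpinChain.IsSiteDissipator k (LD k τ)) →
      (∀ k τ, ‖LD k τ‖ ≤ 1) →
      0 ≤ Γ →
      SpinChain.SupportedOn {b} B →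
      ∀ t : ℝ, t₀ ≤ t →
        ‖SpinChain.timeOrderedExp (fun τ => (∑ i, LH i τ) + (Γ : ℂ) • (∑ k, LD k τ)) t 0 B
          - SpinChain.timeOrderedExp (fun τ => ∑ i, LH i τ) t 0 B‖ ≤ Γ * (C * t ^ 2) * ‖B‖ := by
  obtain ⟨C, hC⟩ := lemma2_general R J t₀ ht₀
  refine ⟨C, fun N q LH LD Γ b B hLH hLH_loc hJ hLD hLD_loc hLD_le hΓ hB => ?_⟩
  exact hC N q LH LD Γ b B hLH (fun i τ => (hLH_loc i τ).isLocalLindbladian) hJ hLD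
    (fun k τ => (hLD_loc k τ).isLocalLindbladian.mono (SpinChain.singleton_subset_nbhd R k)) hLD_le
    hΓ (hB.mono (SpinChain.singleton_subset_nbhd R b))
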